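/- Let $O$ be the four-dimensional oscillator group, i.e. $\mathbb R\times\mathbb C\times\mathbb R$ with the product $$(s,z,t)(s',z',t')=\bigl(s+s'+\tfrac12\operatorname{Im}(\bar z e^{it}z'),\ z+e^{it}z',\ t+t'\bigr),$$ and let $e_0=(1,0,0)$, $e_1=(0,1,0)$, $e_2=(0,i,0)$, $d=(0,0,1)$ be the natural basis of its Lie algebra $\mathfrak o=T_{(0,0,0)}O$; for $a\in\mathfrak o$ let $a^+$ be the left invariant vector field with value $a$ at the identity. Thus $[e_1^+,e_2^+]=e_0^+$, $[d^+,e_1^+]=e_2^+$, $[d^+,e_2^+]=-e_1^+$. For a bilinear product on $\mathfrak o$, let $\nabla$ be the linear connection on $O$ determined by $\nabla_{a^+}b^+=(a\cdot b)^+$ for all $a,b\in\mathfrak o$. Consider the following products, with $e_0\cdot x=x\cdot e_0=0$ for all $x$. * $\mathcal F_1(0,t,s,\frac12)$, where $t,s\ge 0$ are real: $e_1e_1=e_2e_2=te_0$, $e_1e_2=\frac12e_0=-e_2e_1$, $e_1d=e_2d=0$, $de_1=e_2$, $de_2=-e_1$, $dd=se_0$. * $\mathcal F_3(\frac12)$: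 $e_1e_1=e_2e_2=d$, $e_1e_2=\frac12e_0=-e_2e_1$, $e_1d=e_2d=0$, $de_1=e_2$, $de_2=-e_1$, $dd=0$. * $\mathcal F_4(\frac12)$: $e_1e_1=e_2e_2=\frac12e_1+e_2-d$, $e_1e_2=\frac12e_0=-e_2e_1$, $e_1d=\frac12e_0+\frac14e_1+\frac12e_2-\frac12d$, $e_2d=-\frac14e_0+\frac12e_1+e_2-d$, $de_1=\frac12e_0+\frac14e_1+\frac32e_2-\frac12d$, $de_2=-\frac14e_0-\frac12e_1+e_2-d$, $dd=-\frac38e_1+\frac74e_2-\frac54d$. For each of these products the connection $\nabla$ is left invariant, torsion free, has zero curvature (so it is a flat left invariant affine connection), and is geodesically complete: for every $p\in O$ and $v\in T_pO$ there is a smooth curve $c:\mathbb R\to O$ with $c(0)=p$, $c'(0)=v$ and $\nabla_{c'}c'=0$ on all of $\mathbb R$. -/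

import Mathlib

open scoped Manifold ContDiff

noncomputable section

/-- The coordinate space `ℝ × ℂ × ℝ` with coordinates `(s, z, t)`, `z = x₂ + i x₃`. -/
abbrev OscModel : Type := ℝ × ℂ × ℝ

/-- The four-dimensional oscillator group: the manifold `ℝ × ℂ × ℝ` with the multiplication of the
semidirect product `H₃ ⋊ ℝ`, where `H₃ = ℝ × ℂ` carries the product
`(s, w)(s', w') = (s + s' + Im (w̄ w') / 2, w + w')` and `t ∈ ℝ` acts by `(s, z) ↦ (s, e^{it} z)`. -/
def OscGroup : Type := OscModel

namespace OscGroup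

instance : TopologicalSpace OscGroup := inferInstanceAs (TopologicalSpace OscModel)

/-- The single global chart of the oscillator group is the identity. -/
instance : ChartedSpace OscModel OscGroup := inferInstanceAs (ChartedSpace OscModel OscModel)

/-- The global coordinates `(s, z, t)` of a point. -/
def coords (g : OscGroup) : OscModel := g

/-- The point with coordinates `(s, z, t)`. -/
def ofCoords (v : OscModel) : OscGroup := v

/-- `e^{it}`. -/
def rot (t : ℝ) : ℂ := Complex.exp (t * Complex.I)

/-- The group law in coordinates:
`(s, z, t)(s', z', t') = (s + s' + Im (z̄ e^{it} z') / 2, z + e^{it} z', t + t')`. -/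
def mulCoords (g h : OscModel) : OscModel :=
  (g.1 + h.1 + (1 / 2 : ℝ) * (starRingEnd ℂ g.2.1 * (rot g.2.2 * h.2.1)).im,
    g.2.1 + rot g.2.2 * h.2.1, g.2.2 + h.2.2)

/-- The inverse in coordinates. -/
def invCoords (g : OscModel) : OscModel :=
  (-g.1, -(rot (-g.2.2) * g.2.1), -g.2.2)

instance : Mul OscGroup := ⟨fun g h => ofCoords (mulCoords (coords g) (coords h))⟩
instance : One OscGroup := ⟨ofCoords (0, 0, 0)⟩
instance : Inv OscGroup := ⟨fun g => ofCoords (invCoords (coords g))⟩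

theorem rot_zero : rot 0 = 1 := by simp [rot]

theorem rot_add (s t : ℝ) : rot (s + t) = rot s * rot t := by
  simp [rot, add_mul, Complex.exp_add]

theorem rot_neg_mul (t : ℝ) : rot (-t) * rot t = 1 := by
  rw [← rot_add]; simp [rot_zero]

theorem conj_rot (t : ℝ) : starRingEnd ℂ (rot t) = rot (-t) := by
  simp [rot, ← Complex.exp_conj]

theorem contDiff_rot : ContDiff ℝ ω rot := by
  have h : ContDiff ℝ ω (fun t : ℝ => (t : ℂ)) := Complex.ofRealCLM.contDiff
  unfold rot
  fun_prop

instance : Group OscGroup where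
  mul_assoc a b c := by
    change mulCoords (mulCoords a b) c = mulCoords a (mulCoords b c)
    obtain ⟨s, z, t⟩ := a
    obtain ⟨s', z', t'⟩ := b
    obtain ⟨s'', z'', t''⟩ := c
    have h : starRingEnd ℂ (rot t) * rot t = 1 := by rw [conj_rot, rot_neg_mul]
    simp only [mulCoords, rot_add, Prod.mk.injEq, map_add, map_mul, add_mul, mul_add,
      Complex.add_im]
    refine ⟨?_, by ring, by ring⟩
    have : starRingEnd ℂ (rot t) * starRingEnd ℂ z' * (rot t * rot t' * z'') =
        starRingEnd ℂ z' * (rot t' * z'') := by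
      linear_combination (starRingEnd ℂ z' * rot t' * z'') * h
    rw [this, mul_assoc (rot t) (rot t') z'']
    ring
  one_mul a := by
    change mulCoords (0, 0, 0) a = a
    obtain ⟨s, z, t⟩ := a
    simp [mulCoords, rot_zero]
  mul_one a := by
    change mulCoords a (0, 0, 0) = a
    obtain ⟨s, z, t⟩ := a
    simp [mulCoords]
  inv_mul_cancel a := by
    change mulCoords (invCoords a) a = (0, 0, 0)
    obtain ⟨s, z, t⟩ := a
    simp only [mulCoords, invCoords, Prod.mk.injEq]
    refine ⟨?_, by ring, by ring⟩
    have : starRingEnd ℂ (-(rot (-t) * z)) * (rot (-t) * z) = -((Complex.normSq z : ℝ) : ℂ) := by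
      have h := rot_neg_mul t
      rw [map_neg, map_mul, conj_rot, neg_neg, Complex.normSq_eq_conj_mul_self]
      linear_combination (-(starRingEnd ℂ z * z)) * h
    rw [this]
    simp

theorem contDiff_mulCoords : ContDiff ℝ ω (fun p : OscModel × OscModel => mulCoords p.1 p.2) := by
  have h := contDiff_rot
  have hm : ContDiff ℝ ω (fun p : OscModel × OscModel =>
      Complex.imCLM (Complex.conjCLE p.1.2.1 * (rot p.1.2.2 * p.2.2.1))) := by fun_prop
  exact ((contDiff_fst.fst.add contDiff_snd.fst).add (contDiff_const.mul hm)).prodMk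
    (by fun_prop)

theorem contDiff_invCoords : ContDiff ℝ ω invCoords := by
  have h := contDiff_rot
  unfold invCoords
  fun_prop

instance : LieGroup 𝓘(ℝ, OscModel) ω OscGroup where
  toIsManifold := inferInstanceAs (IsManifold 𝓘(ℝ, OscModel) ω OscModel)
  contMDiff_mul := by
    have h : ContMDiff (𝓘(ℝ, OscModel).prod 𝓘(ℝ, OscModel)) 𝓘(ℝ, OscModel × OscModel) ω
        (fun p : OscModel × OscModel => (p.1, p.2)) :=
      ContMDiff.prodMk_space contMDiff_fst contMDiff_snd
    exact contDiff_mulCoords.contMDiff.comp h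
  contMDiff_inv := contDiff_invCoords.contMDiff

/-- The differential at the identity of the left translation by `g`; the Lie algebra, which is the
tangent space at the identity, is `OscModel`. -/
def transOne (g : OscGroup) : OscModel →L[ℝ] TangentSpace 𝓘(ℝ, OscModel) g :=
  mfderiv 𝓘(ℝ, OscModel) 𝓘(ℝ, OscModel) (fun h : OscGroup => g * h) 1

/-- The left Maurer-Cartan form: the differential at `g` of the left translation by `g⁻¹`. -/
def maurerCartan (g : OscGroup) : TangentSpace 𝓘(ℝ, OscModel) g →L[ℝ] OscModel :=
  mfderiv 𝓘(ℝ, OscModel) 𝓘(ℝ, OscModel) (fun h : OscGroup => g⁻¹ * h) g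

/-- The linear part of the left translation by `g` in coordinates. -/
def transCLM (g : OscModel) : OscModel →L[ℝ] OscModel :=
  (ContinuousLinearMap.fst ℝ ℝ (ℂ × ℝ) + (1 / 2 : ℝ) • (Complex.imCLM ∘L
    (ContinuousLinearMap.mul ℝ ℂ (starRingEnd ℂ g.2.1 * rot g.2.2) ∘L
      (ContinuousLinearMap.fst ℝ ℂ ℝ ∘L ContinuousLinearMap.snd ℝ ℝ (ℂ × ℝ))))).prod
  ((ContinuousLinearMap.mul ℝ ℂ (rot g.2.2) ∘L
      (ContinuousLinearMap.fst ℝ ℂ ℝ ∘L ContinuousLinearMap.snd ℝ ℝ (ℂ × ℝ))).prod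
    (ContinuousLinearMap.snd ℝ ℂ ℝ ∘L ContinuousLinearMap.snd ℝ ℝ (ℂ × ℝ)))

theorem transCLM_apply (g v : OscModel) : transCLM g v =
    (v.1 + (1 / 2 : ℝ) * (starRingEnd ℂ g.2.1 * rot g.2.2 * v.2.1).im,
      rot g.2.2 * v.2.1, v.2.2) := rfl

theorem mulCoords_eq (g h : OscModel) : mulCoords g h = g + transCLM g h := by
  rw [transCLM_apply, mulCoords]
  ext <;> simp [mul_assoc, add_assoc]

theorem mfderiv_mul_left (g h : OscGroup) :
    mfderiv 𝓘(ℝ, OscModel) 𝓘(ℝ, OscModel) (fun k : OscGroup => g * k) h =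
      transCLM (coords g) := by
  have h1 : HasFDerivAt (fun k : OscModel => mulCoords (coords g) k) (transCLM (coords g))
      (coords h) := by
    simp only [mulCoords_eq]
    exact (transCLM (coords g)).hasFDerivAt.const_add (coords g)
  exact h1.hasMFDerivAt.mfderiv

theorem transOne_eq (g : OscGroup) : transOne g = transCLM (coords g) :=
  mfderiv_mul_left g 1

theorem maurerCartan_eq (g : OscGroup) : maurerCartan g = transCLM (invCoords (coords g)) :=
  mfderiv_mul_left g⁻¹ g

theorem maurerCartan_transOne (g : OscGroup) (v : OscModel) :
    maurerCartan g (transOne g v) = v := by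
  rw [maurerCartan_eq, transOne_eq]
  change transCLM (invCoords g) (transCLM g v) = v
  obtain ⟨s, z, t⟩ := g
  obtain ⟨a, w, b⟩ := v
  have h := rot_neg_mul t
  have h1 : starRingEnd ℂ (-(rot (-t) * z)) * rot (-t) * (rot t * w) =
      -(starRingEnd ℂ z * rot t * w) := by
    rw [map_neg, map_mul, conj_rot, neg_neg]
    linear_combination (-(starRingEnd ℂ z * rot t * w)) * h
  have h2 : rot (-t) * (rot t * w) = w := by linear_combination w * h
  simp only [transCLM_apply, invCoords, h1, h2, Complex.neg_im]
  ext <;> (simp; try ring)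

theorem transOne_maurerCartan (g : OscGroup) (v : TangentSpace 𝓘(ℝ, OscModel) g) :
    transOne g (maurerCartan g v) = v := by
  rw [maurerCartan_eq, transOne_eq]
  change transCLM g (transCLM (invCoords g) v) = v
  obtain ⟨s, z, t⟩ := g
  obtain ⟨a, w, b⟩ := v
  have h := rot_neg_mul t
  have h1 : starRingEnd ℂ (-(rot (-t) * z)) * rot (-t) * w = -(starRingEnd ℂ z * w) := by
    rw [map_neg, map_mul, conj_rot, neg_neg]
    linear_combination (-(starRingEnd ℂ z * w)) * h
  have h2 : starRingEnd ℂ z * rot t * (rot (-t) * w) = starRingEnd ℂ z * w := by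
    linear_combination (starRingEnd ℂ z * w) * h
  have h3 : rot t * (rot (-t) * w) = w := by linear_combination w * h
  simp only [transCLM_apply, invCoords, h1, h2, h3, Complex.neg_im]
  ext <;> (simp; try ring)

/-- A vector field written in the left invariant frame, as a function with values in the
Lie algebra. -/
def frameCoeff (Y : Π g : OscGroup, TangentSpace 𝓘(ℝ, OscModel) g) (g : OscGroup) : OscModel :=
  maurerCartan g (Y g)

theorem maurerCartan_apply (g : OscGroup) (v : TangentSpace 𝓘(ℝ, OscModel) g) :
    maurerCartan g v = ((v : OscModel).1 -
      (1 / 2 : ℝ) * Complex.imCLM (Complex.conjCLE (coords g).2.1 * (v : OscModel).2.1),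
      rot (-(coords g).2.2) * (v : OscModel).2.1, (v : OscModel).2.2) := by
  rw [maurerCartan_eq]
  refine (transCLM_apply (invCoords (coords g)) v).trans ?_
  obtain ⟨s, z, t⟩ : OscModel := coords g
  obtain ⟨a, w, b⟩ : OscModel := v
  have h1 : starRingEnd ℂ (-(rot (-t) * z)) * rot (-t) * w = -(starRingEnd ℂ z * w) := by
    rw [map_neg, map_mul, conj_rot, neg_neg]
    linear_combination (-(starRingEnd ℂ z * w)) * rot_neg_mul t
  simp only [invCoords, h1, Complex.neg_im]
  ext <;> (simp; try ring)

theorem mdifferentiableAt_frameCoeff {Y : Π g : OscGroup, TangentSpace 𝓘(ℝ, OscModel) g}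
    {g : OscGroup} (hY : MDifferentiableAt 𝓘(ℝ, OscModel) 𝓘(ℝ, OscModel).tangent
      (fun g => (⟨g, Y g⟩ : TangentBundle 𝓘(ℝ, OscModel) OscGroup)) g) :
    MDifferentiableAt 𝓘(ℝ, OscModel) 𝓘(ℝ, OscModel) (frameCoeff Y) g := by
  have h0 := (contMDiff_snd_tangentBundle_modelSpace (n := 1) OscModel
    𝓘(ℝ, OscModel)).mdifferentiable one_ne_zero ⟨coords g, Y g⟩
  have hY' : MDifferentiableAt 𝓘(ℝ, OscModel) 𝓘(ℝ, OscModel).tangent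
      (fun k : OscModel => (⟨k, Y k⟩ : TangentBundle 𝓘(ℝ, OscModel) OscModel)) (coords g) := hY
  have h1 : DifferentiableAt ℝ (fun k : OscModel => (Y k : OscModel)) (coords g) :=
    (show MDifferentiableAt 𝓘(ℝ, OscModel) 𝓘(ℝ, OscModel) (fun k : OscModel => (Y k : OscModel))
      (coords g) from MDifferentiableAt.comp (f := fun k : OscModel =>
        (⟨k, Y k⟩ : TangentBundle 𝓘(ℝ, OscModel) OscModel)) (coords g) h0 hY').differentiableAt
  have h2 : Differentiable ℝ rot := contDiff_rot.differentiable (by simp)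
  have h3 : (fun k : OscModel => frameCoeff Y k) = fun k : OscModel =>
      ((Y k : OscModel).1 - (1 / 2 : ℝ) * Complex.imCLM (Complex.conjCLE k.2.1 *
        (Y k : OscModel).2.1), rot (-k.2.2) * (Y k : OscModel).2.1, (Y k : OscModel).2.2) :=
    funext fun k => maurerCartan_apply k (Y k)
  have h4 : DifferentiableAt ℝ (fun k : OscModel => frameCoeff Y k) (coords g) := by
    rw [h3]
    have h5 := h1.fst
    have h6 := h1.snd.fst
    have h7 := h1.snd.snd
    fun_prop
  exact h4.mdifferentiableAt

/-- The left invariant connection with `∇_{a⁺} b⁺ = (P a b)⁺` for left invariant vector fields: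
if `Y = ∑ yᵢ eᵢ⁺` in a left invariant frame, then
`∇_u Y = ∑ (u yᵢ) eᵢ⁺ + (P u' y)⁺`, where `u'` is `u` moved to the identity. -/
def leftInvariantConnection (P : OscModel →L[ℝ] OscModel →L[ℝ] OscModel) :
    CovariantDerivative 𝓘(ℝ, OscModel) OscModel
      (fun g : OscGroup => TangentSpace 𝓘(ℝ, OscModel) g) where
  toFun Y g := transOne g ∘L
    (mvfderiv 𝓘(ℝ, OscModel) (frameCoeff Y) g
      + P.flip (frameCoeff Y g) ∘L maurerCartan g)
  isCovariantDerivativeOnUniv := by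
    constructor
    · intro Y Z g hY hZ _
      have h : frameCoeff (Y + Z) = frameCoeff Y + frameCoeff Z := by
        funext g; exact map_add (maurerCartan g) _ _
      rw [h, mvfderiv_add (mdifferentiableAt_frameCoeff hY) (mdifferentiableAt_frameCoeff hZ)]
      ext1 u
      simp only [ContinuousLinearMap.comp_apply, add_apply,
        ContinuousLinearMap.flip_apply, Pi.add_apply, map_add]
      abel
    · intro Y f g hY hf _
      have h : frameCoeff (f • Y) = f • frameCoeff Y := by
        funext g; exact map_smul (maurerCartan g) _ _
      rw [h, mvfderiv_smul hf (mdifferentiableAt_frameCoeff hY)]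
      ext1 u
      have h2 : transOne g (frameCoeff Y g) = Y g := transOne_maurerCartan g (Y g)
      simp only [ContinuousLinearMap.comp_apply, add_apply,
        ContinuousLinearMap.flip_apply, Pi.smul_apply', map_add, map_smul,
        smul_apply, ContinuousLinearMap.smulRight_apply, h2, smul_add]
      abel

theorem leftInvariantConnection_transOne (P : OscModel →L[ℝ] OscModel →L[ℝ] OscModel)
    (a b : OscModel) (g : OscGroup) :
    leftInvariantConnection P (fun k => transOne k b) g (transOne g a) = transOne g (P a b) := by
  have h : frameCoeff (fun k => transOne k b) = fun _ => b :=
    funext fun k => maurerCartan_transOne k b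
  have h2 : mvfderiv 𝓘(ℝ, OscModel) (frameCoeff (fun k => transOne k b)) g = 0 := by
    rw [h]
    refine ContinuousLinearMap.ext fun u => ?_
    simp [mvfderiv]
  change transOne g ((mvfderiv 𝓘(ℝ, OscModel) (frameCoeff (fun k => transOne k b)) g)
    (transOne g a) + P (maurerCartan g (transOne g a)) (maurerCartan g (transOne g b))) = _
  rw [h2, maurerCartan_transOne, maurerCartan_transOne, zero_apply, zero_add]

/-- The defining property: `∇_{a⁺} b⁺ = (P a b)⁺` for the left invariant vector fields. -/
theorem leftInvariantConnection_mulInvariantVectorField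
    (P : OscModel →L[ℝ] OscModel →L[ℝ] OscModel) (a b : GroupLieAlgebra 𝓘(ℝ, OscModel) OscGroup)
    (g : OscGroup) :
    leftInvariantConnection P (mulInvariantVectorField b) g (mulInvariantVectorField a g) =
      mulInvariantVectorField
        (P a b : GroupLieAlgebra 𝓘(ℝ, OscModel) OscGroup) g :=
  leftInvariantConnection_transOne P a b g

/-- Linear connections on the oscillator group, as covariant derivatives; `D Y g (X g)` is
`∇_X Y` at `g`. -/
abbrev Connection : Type :=
  CovariantDerivative 𝓘(ℝ, OscModel) OscModel
    (fun g : OscGroup => TangentSpace 𝓘(ℝ, OscModel) g)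

/-- Smooth vector fields on the oscillator group. -/
def IsSmoothField (X : Π g : OscGroup, TangentSpace 𝓘(ℝ, OscModel) g) : Prop :=
  ContMDiff 𝓘(ℝ, OscModel) 𝓘(ℝ, OscModel).tangent ∞
    (fun g => (⟨g, X g⟩ : TangentBundle 𝓘(ℝ, OscModel) OscGroup))

/-- All left translations are affine transformations: they pull back `∇_X Y` to the covariant
derivative of the pulled back vector fields. -/
def IsLeftInvariant (D : Connection) : Prop :=
  ∀ (g : OscGroup) (X Y : Π g : OscGroup, TangentSpace 𝓘(ℝ, OscModel) g),
    IsSmoothField X → IsSmoothField Y → ∀ k : OscGroup,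
      VectorField.mpullback 𝓘(ℝ, OscModel) 𝓘(ℝ, OscModel) (fun h : OscGroup => g * h)
          (fun h => D Y h (X h)) k =
        D (VectorField.mpullback 𝓘(ℝ, OscModel) 𝓘(ℝ, OscModel) (fun h : OscGroup => g * h) Y) k
          (VectorField.mpullback 𝓘(ℝ, OscModel) 𝓘(ℝ, OscModel) (fun h : OscGroup => g * h) X k)

/-- Vanishing torsion: `∇_X Y - ∇_Y X = [X, Y]`. -/
def IsTorsionFree (D : Connection) : Prop :=
  ∀ X Y : Π g : OscGroup, TangentSpace 𝓘(ℝ, OscModel) g,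
    IsSmoothField X → IsSmoothField Y → ∀ g : OscGroup,
      D Y g (X g) - D X g (Y g) = VectorField.mlieBracket 𝓘(ℝ, OscModel) X Y g

/-- Vanishing curvature: `∇_X ∇_Y Z - ∇_Y ∇_X Z = ∇_{[X, Y]} Z`. -/
def IsCurvatureFree (D : Connection) : Prop :=
  ∀ X Y Z : Π g : OscGroup, TangentSpace 𝓘(ℝ, OscModel) g,
    IsSmoothField X → IsSmoothField Y → IsSmoothField Z → ∀ g : OscGroup,
      D (fun k => D Z k (Y k)) g (X g) - D (fun k => D Z k (X k)) g (Y g) =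
        D Z g (VectorField.mlieBracket 𝓘(ℝ, OscModel) X Y g)

/-- The Christoffel symbols in the global coordinates, `Γ_g(u, v) = ∇_u V` at `g`, where `V` is the
vector field with constant components `v`. -/
def christoffel (D : Connection) (g : OscGroup) (u v : OscModel) : OscModel :=
  D (fun _ => (v : OscModel)) g u

/-- Affinely parametrized geodesics defined on the whole line: smooth curves `c` with
`∇_{c'} c' = 0`, that is, `c'' + Γ_c(c', c') = 0` in the global coordinates. -/
def IsGeodesic (D : Connection) (c : ℝ → OscGroup) : Prop :=
  ContDiff ℝ ∞ (fun r => coords (c r)) ∧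
    ∀ r : ℝ, deriv (deriv fun r => coords (c r)) r +
      christoffel D (c r) (deriv (fun r => coords (c r)) r) (deriv (fun r => coords (c r)) r) = 0

/-- Every initial point and initial velocity belong to a geodesic defined on the whole line. -/
def IsGeodesicallyComplete (D : Connection) : Prop :=
  ∀ (p : OscGroup) (v : OscModel), ∃ c : ℝ → OscGroup,
    IsGeodesic D c ∧ c 0 = p ∧ deriv (fun r => coords (c r)) 0 = v

/-- The basis vector `e₀` of the Lie algebra. -/
def e₀ : OscModel := (1, 0, 0)

/-- The basis vector `e₁` of the Lie algebra. -/
def e₁ : OscModel := (0, 1, 0)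

/-- The basis vector `e₂` of the Lie algebra. -/
def e₂ : OscModel := (0, Complex.I, 0)

/-- The basis vector `d` of the Lie algebra. -/
def d : OscModel := (0, 0, 1)

/-- The coordinate functionals of the basis `e₀, e₁, e₂, d`. -/
def coordCLM : Fin 4 → OscModel →L[ℝ] ℝ :=
  ![ContinuousLinearMap.fst ℝ ℝ (ℂ × ℝ),
    Complex.reCLM ∘L ContinuousLinearMap.fst ℝ ℂ ℝ ∘L ContinuousLinearMap.snd ℝ ℝ (ℂ × ℝ),
    Complex.imCLM ∘L ContinuousLinearMap.fst ℝ ℂ ℝ ∘L ContinuousLinearMap.snd ℝ ℝ (ℂ × ℝ),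
    ContinuousLinearMap.snd ℝ ℂ ℝ ∘L ContinuousLinearMap.snd ℝ ℝ (ℂ × ℝ)]

/-- The bilinear product with the given multiplication table: the row `i` and column `j` hold the
product of the `i`-th and the `j`-th element of the basis `e₀, e₁, e₂, d`. -/
def tableProduct (T : Fin 4 → Fin 4 → OscModel) : OscModel →L[ℝ] OscModel →L[ℝ] OscModel :=
  ∑ i, ∑ j, (coordCLM i).smulRight ((coordCLM j).smulRight (T i j))

theorem tableProduct_apply (T : Fin 4 → Fin 4 → OscModel) (a b : OscModel) :
    tableProduct T a b = ∑ i, ∑ j, (coordCLM i a * coordCLM j b) • T i j := by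
  unfold tableProduct
  rw [ContinuousLinearMap.sum_apply, ContinuousLinearMap.sum_apply]
  refine Finset.sum_congr rfl fun i _ => ?_
  rw [ContinuousLinearMap.sum_apply, ContinuousLinearMap.sum_apply]
  refine Finset.sum_congr rfl fun j _ => ?_
  rw [ContinuousLinearMap.smulRight_apply, smul_apply,
    ContinuousLinearMap.smulRight_apply, smul_smul]

/-- The product `𝓕₁(0, t, s, q)`. -/
def prodF₁ (t s q : ℝ) : OscModel →L[ℝ] OscModel →L[ℝ] OscModel :=
  tableProduct
    ![![0, 0, 0, 0],
      ![0, t • e₀, q • e₀, 0],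
      ![0, -(q • e₀), t • e₀, 0],
      ![0, e₂, -e₁, s • e₀]]

/-- The product `𝓕₃(q)`. -/
def prodF₃ (q : ℝ) : OscModel →L[ℝ] OscModel →L[ℝ] OscModel :=
  tableProduct
    ![![0, 0, 0, 0],
      ![0, d, q • e₀, 0],
      ![0, -(q • e₀), d, 0],
      ![0, e₂, -e₁, 0]]

/-- The product `𝓕₄(q)`. -/
def prodF₄ (q : ℝ) : OscModel →L[ℝ] OscModel →L[ℝ] OscModel :=
  tableProduct
    ![![0, 0, 0, 0],
      ![0, (1 / 2 : ℝ) • e₁ + e₂ - d, q • e₀,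
        q • e₀ + (1 / 4 : ℝ) • e₁ + (1 / 2 : ℝ) • e₂ - (1 / 2 : ℝ) • d],
      ![0, -(q • e₀), (1 / 2 : ℝ) • e₁ + e₂ - d,
        -((q / 2) • e₀) + (1 / 2 : ℝ) • e₁ + e₂ - d],
      ![0, q • e₀ + (1 / 4 : ℝ) • e₁ + (3 / 2 : ℝ) • e₂ - (1 / 2 : ℝ) • d,
        -((q / 2) • e₀) - (1 / 2 : ℝ) • e₁ + e₂ - d,
        -((3 / 8 : ℝ) • e₁) + (7 / 4 : ℝ) • e₂ - (5 / 4 : ℝ) • d]]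

end OscGroup
end

noncomputable section

namespace OscGroup

/-! In the left invariant frame a vector field is a function `y` with values in the Lie algebra, and
the connection is `D y (u) + P x y`, where `x` is `u` moved to the identity. Left translations
preserve the frame, so every such connection is left invariant. The bracket of fields is the flat
one plus `bracket x y` (`frameCoords_mlieBracket`), so zero torsion amounts to `P a b - P b a =
bracket a b`, and zero curvature to left symmetry of `P`, all second derivatives cancelling. Both
are polynomial identities in real coordinates.

For completeness, let `x` be the velocity of a curve moved to the identity. The curve is a geodesic
once `x' = -P x x`, and it is recovered from `x` by three successive integrations, so global
solutions of this Euler equation suffice (`isGeodesicallyComplete_of_euler`). For each of the three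
products the equation is solved explicitly: a conserved norm makes the `d`-component affine in time,
and the complex component then rotates with a quadratic phase. -/

/-! ### The connection in the left invariant frame -/

theorem transCLM_invCoords_transCLM (g v : OscModel) :
    transCLM (invCoords g) (transCLM g v) = v := by
  have h := maurerCartan_transOne (ofCoords g) v
  have h1 := maurerCartan_eq (ofCoords g)
  have h2 := transOne_eq (ofCoords g)
  rw [h1, h2] at h
  exact h

theorem transCLM_transCLM_invCoords (g v : OscModel) :
    transCLM g (transCLM (invCoords g) v) = v := by
  have h := transOne_maurerCartan (ofCoords g) v
  have h1 := maurerCartan_eq (ofCoords g)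
  have h2 := transOne_eq (ofCoords g)
  rw [h1, h2] at h
  exact h

theorem transCLM_injective (g : OscModel) : Function.Injective (transCLM g) :=
  Function.LeftInverse.injective (transCLM_invCoords_transCLM g)

/-- The components of a vector field in the global coordinates. -/
def fieldCoords (X : Π g : OscGroup, TangentSpace 𝓘(ℝ, OscModel) g) (k : OscModel) : OscModel :=
  X (ofCoords k)

/-- The components of a vector field in the left invariant frame, as a function of the global
coordinates. -/
def frameCoords (X : Π g : OscGroup, TangentSpace 𝓘(ℝ, OscModel) g) (k : OscModel) : OscModel :=
  frameCoeff X (ofCoords k)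

theorem frameCoords_apply (X : Π g : OscGroup, TangentSpace 𝓘(ℝ, OscModel) g) (k : OscModel) :
    frameCoords X k = transCLM (invCoords k) (fieldCoords X k) :=
  congrArg (fun L : OscModel →L[ℝ] OscModel => L (fieldCoords X k)) (maurerCartan_eq (ofCoords k))

theorem transCLM_frameCoords (X : Π g : OscGroup, TangentSpace 𝓘(ℝ, OscModel) g) (k : OscModel) :
    transCLM k (frameCoords X k) = fieldCoords X k := by
  rw [frameCoords_apply, transCLM_transCLM_invCoords]

theorem eq_of_frameCoords_eq {X Y : Π g : OscGroup, TangentSpace 𝓘(ℝ, OscModel) g} {g : OscGroup}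
    (h : frameCoords X (coords g) = frameCoords Y (coords g)) : X g = Y g :=
  Function.LeftInverse.injective (transOne_maurerCartan g) h

theorem frameCoords_sub (X Y : Π g : OscGroup, TangentSpace 𝓘(ℝ, OscModel) g) (k : OscModel) :
    frameCoords (fun g => X g - Y g) k = frameCoords X k - frameCoords Y k :=
  map_sub (maurerCartan (ofCoords k)) _ _

/-- The connection in the global coordinates. -/
theorem leftInvariantConnection_apply (P : OscModel →L[ℝ] OscModel →L[ℝ] OscModel)
    (Y : Π g : OscGroup, TangentSpace 𝓘(ℝ, OscModel) g) (g : OscGroup) (u : OscModel) :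
    leftInvariantConnection P Y g u = transCLM (coords g) (fderiv ℝ (frameCoords Y) (coords g) u
      + P (transCLM (invCoords (coords g)) u) (frameCoords Y (coords g))) := by
  -- The only chart is the identity, so the manifold derivative is the Fréchet derivative.
  have h : mvfderiv 𝓘(ℝ, OscModel) (frameCoeff Y) g = fderiv ℝ (frameCoords Y) (coords g) :=
    mfderiv_eq_fderiv (f := frameCoords Y) (x := coords g)
  rw [← h, ← maurerCartan_eq, ← transOne_eq]
  rfl

theorem frameCoords_leftInvariantConnection (P : OscModel →L[ℝ] OscModel →L[ℝ] OscModel)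
    (X Y : Π g : OscGroup, TangentSpace 𝓘(ℝ, OscModel) g) :
    frameCoords (fun k => leftInvariantConnection P Y k (X k)) = fun g =>
      fderiv ℝ (frameCoords Y) g (fieldCoords X g) + P (frameCoords X g) (frameCoords Y g) := by
  funext g
  apply transCLM_injective g
  rw [transCLM_frameCoords, frameCoords_apply X]
  exact leftInvariantConnection_apply P Y (ofCoords g) (X (ofCoords g))

theorem IsSmoothField.contDiff {X : Π g : OscGroup, TangentSpace 𝓘(ℝ, OscModel) g}
    (hX : IsSmoothField X) : ContDiff ℝ ∞ (fieldCoords X) :=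
  (contMDiff_vectorSpace_iff_contDiff (𝕜 := ℝ) (V := fieldCoords X)).1 hX

theorem contDiff_frameCoords {n : WithTop ℕ∞} {X : Π g : OscGroup, TangentSpace 𝓘(ℝ, OscModel) g}
    (hX : ContDiff ℝ n (fieldCoords X)) : ContDiff ℝ n (frameCoords X) := by
  have h2 : ContDiff ℝ n rot := contDiff_rot.of_le le_top
  have h3 : frameCoords X = fun k : OscModel =>
      ((fieldCoords X k).1 - (1 / 2 : ℝ) * Complex.imCLM (Complex.conjCLE k.2.1 *
        (fieldCoords X k).2.1), rot (-k.2.2) * (fieldCoords X k).2.1, (fieldCoords X k).2.2) :=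
    funext fun k => maurerCartan_apply (ofCoords k) (X (ofCoords k))
  rw [h3]
  have h5 := hX.fst
  have h6 := hX.snd.fst
  have h7 := hX.snd.snd
  fun_prop

/-! ### Differentiating the frame; the structure equation -/

/-- The derivative of `g ↦ transCLM g v` in the direction `u`. -/
def transDeriv (g u v : OscModel) : OscModel :=
  ((1 / 2 : ℝ) * (starRingEnd ℂ u.2.1 * rot g.2.2 * v.2.1 +
      starRingEnd ℂ g.2.1 * (u.2.2 * Complex.I * rot g.2.2) * v.2.1).im,
    u.2.2 * Complex.I * rot g.2.2 * v.2.1, 0)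

theorem hasDerivAt_rot (t : ℝ) : HasDerivAt rot (Complex.I * rot t) t := by
  have h : HasDerivAt (fun t : ℝ => (t : ℂ) * Complex.I) (1 * Complex.I) t :=
    (Complex.ofRealCLM.hasDerivAt (x := t)).mul_const _
  have h2 := h.cexp
  simp only [one_mul] at h2
  rw [mul_comm]
  exact h2

theorem hasDerivAt_rot_comp {f : ℝ → ℝ} {f' r : ℝ} (hf : HasDerivAt f f' r) :
    HasDerivAt (fun r => rot (f r)) (f' * Complex.I * rot (f r)) r := by
  have h := (hasDerivAt_rot (f r)).scomp r hf
  rw [Complex.real_smul, ← mul_assoc] at h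
  exact h

theorem hasDerivAt_transCLM {c x : ℝ → OscModel} {c' x' : OscModel} {r : ℝ}
    (hc : HasDerivAt c c' r) (hx : HasDerivAt x x' r) :
    HasDerivAt (fun r => transCLM (c r) (x r))
      (transCLM (c r) x' + transDeriv (c r) c' (x r)) r := by
  have c1 : HasDerivAt (fun r => (c r).2.1) c'.2.1 r := hc.snd.fst
  have c2 : HasDerivAt (fun r => (c r).2.2) c'.2.2 r := hc.snd.snd
  have x0 : HasDerivAt (fun r => (x r).1) x'.1 r := hx.fst
  have x1 : HasDerivAt (fun r => (x r).2.1) x'.2.1 r := hx.snd.fst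
  have x2 : HasDerivAt (fun r => (x r).2.2) x'.2.2 r := hx.snd.snd
  have h1 := hasDerivAt_rot_comp c2
  have h2 : HasDerivAt (fun r => starRingEnd ℂ (c r).2.1) (starRingEnd ℂ c'.2.1) r :=
    Complex.conjCLE.toContinuousLinearMap.hasFDerivAt.comp_hasDerivAt r c1
  have h3 : HasDerivAt (fun r => (starRingEnd ℂ (c r).2.1 * rot (c r).2.2 * (x r).2.1).im) _ r :=
    Complex.imCLM.hasFDerivAt.comp_hasDerivAt r ((h2.mul h1).mul x1)
  have h4 := (x0.add (h3.const_mul (1 / 2 : ℝ))).prodMk ((h1.mul x1).prodMk x2)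
  refine h4.congr_deriv ?_
  simp only [transCLM_apply, transDeriv, Complex.imCLM_apply, Complex.add_im, Pi.mul_apply,
    add_mul]
  ext <;> (simp; try ring)

/-- This is the product rule for curves, applied along the line `g + r • u`. -/
theorem fderiv_transCLM {y : OscModel → OscModel} {g : OscModel} (hy : DifferentiableAt ℝ y g)
    {W : OscModel → OscModel} (hW : DifferentiableAt ℝ W g) (h : ∀ k, W k = transCLM k (y k))
    (u : OscModel) : fderiv ℝ W g u = transCLM g (fderiv ℝ y g u) + transDeriv g u (y g) := by
  have hl : HasDerivAt (fun r : ℝ => g + r • u) u 0 := by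
    simpa using ((hasDerivAt_id (0 : ℝ)).smul_const u).const_add g
  have h0 : g + (0 : ℝ) • u = g := by simp
  have h1 : HasDerivAt (fun r : ℝ => y (g + r • u)) (fderiv ℝ y g u) 0 :=
    HasFDerivAt.comp_hasDerivAt (0 : ℝ) (by rw [h0]; exact hy.hasFDerivAt) hl
  have h2 : HasDerivAt (fun r : ℝ => W (g + r • u)) (fderiv ℝ W g u) 0 :=
    HasFDerivAt.comp_hasDerivAt (0 : ℝ) (by rw [h0]; exact hW.hasFDerivAt) hl
  have h3 := hasDerivAt_transCLM hl h1
  simp only [← h, h0] at h3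
  exact h2.unique h3

/-- The Lie bracket of the oscillator algebra. -/
def bracket (a b : OscModel) : OscModel :=
  ((starRingEnd ℂ a.2.1 * b.2.1).im, Complex.I * (a.2.2 * b.2.1 - b.2.2 * a.2.1), 0)

/-- This is `[a⁺, b⁺] = [a, b]⁺` in coordinates: `transDeriv` differentiates one left invariant
field along the other. -/
theorem transDeriv_sub_transDeriv (g a b : OscModel) :
    transDeriv g (transCLM g a) b - transDeriv g (transCLM g b) a = transCLM g (bracket a b) := by
  have h : ∀ v w : ℂ, starRingEnd ℂ (rot g.2.2 * v) * rot g.2.2 * w = starRingEnd ℂ v * w := by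
    intro v w
    rw [map_mul, conj_rot]
    linear_combination (starRingEnd ℂ v * w) * rot_neg_mul g.2.2
  simp only [transDeriv, transCLM_apply, bracket, h]
  ext
  · simp
    ring
  · simp
    ring
  · simp

theorem fderiv_fieldCoords {X : Π g : OscGroup, TangentSpace 𝓘(ℝ, OscModel) g}
    (hX : ContDiff ℝ 1 (fieldCoords X)) (g u : OscModel) :
    fderiv ℝ (fieldCoords X) g u =
      transCLM g (fderiv ℝ (frameCoords X) g u) + transDeriv g u (frameCoords X g) :=
  fderiv_transCLM ((contDiff_frameCoords hX).differentiable one_ne_zero g)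
    (hX.differentiable one_ne_zero g) (fun k => (transCLM_frameCoords X k).symm) u

theorem fieldCoords_mlieBracket (X Y : Π g : OscGroup, TangentSpace 𝓘(ℝ, OscModel) g)
    (g : OscModel) : fieldCoords (VectorField.mlieBracket 𝓘(ℝ, OscModel) X Y) g =
      fderiv ℝ (fieldCoords Y) g (fieldCoords X g) -
        fderiv ℝ (fieldCoords X) g (fieldCoords Y g) := by
  have h := congrFun (VectorField.mlieBracketWithin_eq_lieBracketWithin (𝕜 := ℝ)
    (V := fieldCoords X) (W := fieldCoords Y) (s := Set.univ)) g
  have h0 := congrFun (VectorField.mlieBracketWithin_univ (I := 𝓘(ℝ, OscModel)) (V := X)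
    (W := Y)) (ofCoords g)
  refine h0.symm.trans (h.trans ?_)
  exact congrFun (VectorField.lieBracketWithin_univ (𝕜 := ℝ) (V := fieldCoords X)
    (W := fieldCoords Y)) g

theorem frameCoords_mlieBracket {X Y : Π g : OscGroup, TangentSpace 𝓘(ℝ, OscModel) g}
    (hX : ContDiff ℝ 1 (fieldCoords X)) (hY : ContDiff ℝ 1 (fieldCoords Y)) (g : OscModel) :
    frameCoords (VectorField.mlieBracket 𝓘(ℝ, OscModel) X Y) g =
      fderiv ℝ (frameCoords Y) g (fieldCoords X g) -
        fderiv ℝ (frameCoords X) g (fieldCoords Y g) +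
        bracket (frameCoords X g) (frameCoords Y g) := by
  apply transCLM_injective g
  rw [transCLM_frameCoords, fieldCoords_mlieBracket, fderiv_fieldCoords hX,
    fderiv_fieldCoords hY, map_add, map_sub, ← transDeriv_sub_transDeriv, transCLM_frameCoords,
    transCLM_frameCoords]
  abel

/-! ### Torsion and curvature -/

theorem isTorsionFree_leftInvariantConnection {P : OscModel →L[ℝ] OscModel →L[ℝ] OscModel}
    (hP : ∀ a b, P a b - P b a = bracket a b) : IsTorsionFree (leftInvariantConnection P) := by
  intro X Y hX hY g
  refine eq_of_frameCoords_eq (X := fun g => leftInvariantConnection P Y g (X g) -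
    leftInvariantConnection P X g (Y g)) ?_
  rw [frameCoords_sub, frameCoords_leftInvariantConnection, frameCoords_leftInvariantConnection,
    frameCoords_mlieBracket (hX.contDiff.of_le (by simp)) (hY.contDiff.of_le (by simp)), ← hP]
  beta_reduce
  abel

theorem fderiv_frameCoords_leftInvariantConnection (P : OscModel →L[ℝ] OscModel →L[ℝ] OscModel)
    {Y Z : Π g : OscGroup, TangentSpace 𝓘(ℝ, OscModel) g}
    (hY : ContDiff ℝ 1 (fieldCoords Y)) (hZ : ContDiff ℝ 2 (fieldCoords Z)) (g u : OscModel) :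
    fderiv ℝ (frameCoords (fun k => leftInvariantConnection P Z k (Y k))) g u =
      fderiv ℝ (fderiv ℝ (frameCoords Z)) g u (fieldCoords Y g) +
      fderiv ℝ (frameCoords Z) g (fderiv ℝ (fieldCoords Y) g u) +
      P (frameCoords Y g) (fderiv ℝ (frameCoords Z) g u) +
      P (fderiv ℝ (frameCoords Y) g u) (frameCoords Z g) := by
  have dY := hY.differentiable one_ne_zero g
  have dy := (contDiff_frameCoords hY).differentiable one_ne_zero g
  have dz := (contDiff_frameCoords hZ).differentiable two_ne_zero g
  have ddz := ((contDiff_frameCoords hZ).fderiv_right (m := 1) le_rfl).differentiable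
    one_ne_zero g
  have h1 := ddz.hasFDerivAt.clm_apply dY.hasFDerivAt
  have h2 := (P.hasFDerivAt.comp g dy.hasFDerivAt).clm_apply dz.hasFDerivAt
  rw [frameCoords_leftInvariantConnection]
  refine (congrArg (fun L : OscModel →L[ℝ] OscModel => L u) (h1.add h2).fderiv).trans ?_
  simp only [add_apply, ContinuousLinearMap.comp_apply, ContinuousLinearMap.flip_apply,
    Function.comp_apply]
  abel

theorem isCurvatureFree_leftInvariantConnection {P : OscModel →L[ℝ] OscModel →L[ℝ] OscModel}
    (hP : ∀ a b c, P a (P b c) - P b (P a c) = P (bracket a b) c) :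
    IsCurvatureFree (leftInvariantConnection P) := by
  intro X Y Z hX hY hZ g
  have hX1 : ContDiff ℝ 1 (fieldCoords X) := hX.contDiff.of_le (by simp)
  have hY1 : ContDiff ℝ 1 (fieldCoords Y) := hY.contDiff.of_le (by simp)
  have hZ2 : ContDiff ℝ 2 (fieldCoords Z) := hZ.contDiff.of_le (WithTop.coe_le_coe.2 le_top)
  -- Needed to cancel the second derivatives of `Z`. The mixed terms `P x (D z Y) + P y (D z X)` are
  -- symmetric in the two fields, and the rest is left symmetry.
  have hsymm : IsSymmSndFDerivAt ℝ (frameCoords Z) (coords g) :=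
    (contDiff_frameCoords hZ2).contDiffAt.isSymmSndFDerivAt (by simp)
  refine eq_of_frameCoords_eq (X := fun g =>
    leftInvariantConnection P (fun k => leftInvariantConnection P Z k (Y k)) g (X g) -
      leftInvariantConnection P (fun k => leftInvariantConnection P Z k (X k)) g (Y g))
    (Y := fun g => leftInvariantConnection P Z g (VectorField.mlieBracket 𝓘(ℝ, OscModel) X Y g)) ?_
  rw [frameCoords_sub,
    frameCoords_leftInvariantConnection P X (fun k => leftInvariantConnection P Z k (Y k)),
    frameCoords_leftInvariantConnection P Y (fun k => leftInvariantConnection P Z k (X k))]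
  beta_reduce
  rw [fderiv_frameCoords_leftInvariantConnection P hY1 hZ2,
    fderiv_frameCoords_leftInvariantConnection P hX1 hZ2,
    frameCoords_leftInvariantConnection P _ Z, frameCoords_leftInvariantConnection P _ Z,
    frameCoords_leftInvariantConnection P _ Z]
  beta_reduce
  rw [frameCoords_mlieBracket hX1 hY1, fieldCoords_mlieBracket]
  rw [hsymm (fieldCoords X (coords g)) (fieldCoords Y (coords g))]
  simp only [map_add, map_sub, add_apply, sub_apply, ← hP]
  abel

/-! ### Left invariance -/

/-- Left translations are affine in these coordinates, so this is the linear part of associativity.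
-/
theorem transCLM_mulCoords (g k v : OscModel) :
    transCLM (mulCoords g k) v = transCLM g (transCLM k v) := by
  have h : mulCoords (mulCoords g k) v = mulCoords g (mulCoords k v) :=
    mul_assoc (ofCoords g) (ofCoords k) (ofCoords v)
  simpa only [mulCoords_eq, map_add, add_assoc, add_right_inj] using h

/-- The linear part of a left translation as a linear equivalence. -/
def transCLE (g : OscModel) : OscModel ≃L[ℝ] OscModel :=
  ContinuousLinearEquiv.equivOfInverse (transCLM g) (transCLM (invCoords g))
    (transCLM_invCoords_transCLM g) (transCLM_transCLM_invCoords g)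

theorem fieldCoords_mpullback_mul (X : Π g : OscGroup, TangentSpace 𝓘(ℝ, OscModel) g)
    (g : OscGroup) (k : OscModel) :
    fieldCoords (VectorField.mpullback 𝓘(ℝ, OscModel) 𝓘(ℝ, OscModel)
      (fun h : OscGroup => g * h) X) k =
        transCLM (invCoords (coords g)) (fieldCoords X (mulCoords (coords g) k)) := by
  -- `mpullback` uses `ContinuousLinearMap.inverse`, which is zero on non-invertible maps;
  -- exhibiting an equivalence gives the true inverse.
  have h1 := ContinuousLinearMap.inverse_equiv (transCLE (coords g))
  have h2 := mfderiv_mul_left g (ofCoords k)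
  refine (congrArg (fun L : OscModel →L[ℝ] OscModel =>
    L.inverse (fieldCoords X (mulCoords (coords g) k))) h2).trans ?_
  exact congrArg (fun L : OscModel →L[ℝ] OscModel =>
    L (fieldCoords X (mulCoords (coords g) k))) h1

/-- The frame is invariant, so pulling back only moves the base point; left invariance is then the
chain rule. -/
theorem frameCoords_mpullback_mul (X : Π g : OscGroup, TangentSpace 𝓘(ℝ, OscModel) g)
    (g : OscGroup) :
    frameCoords (VectorField.mpullback 𝓘(ℝ, OscModel) 𝓘(ℝ, OscModel)
      (fun h : OscGroup => g * h) X) = fun k => frameCoords X (mulCoords (coords g) k) := by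
  funext k
  apply transCLM_injective (mulCoords (coords g) k)
  rw [transCLM_frameCoords, transCLM_mulCoords, transCLM_frameCoords, fieldCoords_mpullback_mul,
    transCLM_transCLM_invCoords]

theorem isLeftInvariant_leftInvariantConnection (P : OscModel →L[ℝ] OscModel →L[ℝ] OscModel) :
    IsLeftInvariant (leftInvariantConnection P) := by
  intro g X Y _ hY k
  refine eq_of_frameCoords_eq (Y := fun k => leftInvariantConnection P
    (VectorField.mpullback 𝓘(ℝ, OscModel) 𝓘(ℝ, OscModel) (fun h : OscGroup => g * h) Y) k
    (VectorField.mpullback 𝓘(ℝ, OscModel) 𝓘(ℝ, OscModel) (fun h : OscGroup => g * h) X k)) ?_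
  have h1 : HasFDerivAt (fun k => mulCoords (coords g) k) (transCLM (coords g)) (coords k) := by
    simp only [mulCoords_eq]
    exact (transCLM (coords g)).hasFDerivAt.const_add (coords g)
  have h2 := (contDiff_frameCoords hY.contDiff).differentiable (by simp)
    (mulCoords (coords g) (coords k))
  have h3 := (h2.hasFDerivAt.comp (coords k) h1).fderiv
  simp only [Function.comp_def] at h3
  rw [frameCoords_mpullback_mul, frameCoords_leftInvariantConnection,
    frameCoords_leftInvariantConnection, frameCoords_mpullback_mul, frameCoords_mpullback_mul]
  beta_reduce
  rw [h3, fieldCoords_mpullback_mul, ContinuousLinearMap.comp_apply, transCLM_transCLM_invCoords]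

/-! ### Geodesics and the Euler equation -/

theorem christoffel_leftInvariantConnection (P : OscModel →L[ℝ] OscModel →L[ℝ] OscModel)
    (g : OscGroup) (x y : OscModel) :
    christoffel (leftInvariantConnection P) g (transCLM (coords g) x) (transCLM (coords g) y) =
      transCLM (coords g) (P x y) - transDeriv (coords g) (transCLM (coords g) x) y := by
  set v := transCLM (coords g) y with hv
  -- The field with constant components has zero derivative, so the product rule expresses the
  -- derivative of its frame components through `transDeriv`.
  have h0 : ContDiff ℝ 1 (fieldCoords fun _ => v) := contDiff_const
  have h1 := fderiv_fieldCoords h0 (coords g) (transCLM (coords g) x)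
  have h2 : fderiv ℝ (fieldCoords fun _ => v) (coords g) (transCLM (coords g) x) = 0 := by
    have : (fieldCoords fun _ => v) = fun _ => v := rfl
    rw [this]
    simp
  have h3 : frameCoords (fun _ => v) (coords g) = y :=
    (frameCoords_apply _ _).trans (transCLM_invCoords_transCLM (coords g) y)
  rw [h2, h3] at h1
  refine (leftInvariantConnection_apply P (fun _ => v) g (transCLM (coords g) x)).trans ?_
  have h4 : ∀ a b c : OscModel, 0 = a + c → a + b = b - c := by
    intro a b c h
    rw [eq_sub_iff_add_eq, add_right_comm, ← h, zero_add]
  rw [h3, map_add, transCLM_invCoords_transCLM]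
  exact h4 _ _ _ h1

theorem exists_contDiff_antideriv {E : Type*} [NormedAddCommGroup E] [NormedSpace ℝ E]
    [CompleteSpace E] {f : ℝ → E} (hf : ContDiff ℝ ∞ f) (a : E) :
    ∃ F : ℝ → E, ContDiff ℝ ∞ F ∧ F 0 = a ∧ ∀ r, HasDerivAt F (f r) r := by
  have h : ∀ r, HasDerivAt (fun r => a + ∫ u in (0 : ℝ)..r, f u) (f r) r := fun r =>
    (intervalIntegral.integral_hasDerivAt_right (hf.continuous.intervalIntegrable _ _)
      (hf.continuous.stronglyMeasurableAtFilter _ _) hf.continuous.continuousAt).const_add a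
  refine ⟨_, ?_, by simp, h⟩
  rw [contDiff_infty_iff_deriv]
  refine ⟨fun r => (h r).differentiableAt, ?_⟩
  rwa [show deriv (fun r => a + ∫ u in (0 : ℝ)..r, f u) = f from funext fun r => (h r).deriv]

/-- Every smooth curve in the Lie algebra is the left logarithmic derivative of a smooth curve. -/
theorem exists_contDiff_hasDerivAt_transCLM {x : ℝ → OscModel} (hx : ContDiff ℝ ∞ x)
    (p : OscModel) : ∃ c : ℝ → OscModel, ContDiff ℝ ∞ c ∧ c 0 = p ∧
      ∀ r, HasDerivAt c (transCLM (c r) (x r)) r := by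
  have hrot : ContDiff ℝ ∞ rot := contDiff_rot.of_le le_top
  have h0 := hx.fst
  have h1 := hx.snd.fst
  have h2 := hx.snd.snd
  -- The system is triangular: `τ'` depends on `x` alone, `z'` on `x` and `τ`, `s'` on `x`, `τ` and
  -- `z`. Hence no existence theorem for differential equations is needed.
  obtain ⟨τ, hτ, hτ0, hτ'⟩ := exists_contDiff_antideriv h2 p.2.2
  have hz1 : ContDiff ℝ ∞ (fun r => rot (τ r) * (x r).2.1) := (hrot.comp hτ).mul h1
  obtain ⟨z, hz, hz0, hz'⟩ := exists_contDiff_antideriv hz1 p.2.1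
  have hs1 : ContDiff ℝ ∞ (fun r => (x r).1 +
      (1 / 2 : ℝ) * Complex.imCLM (Complex.conjCLE (z r) * rot (τ r) * (x r).2.1)) := by
    fun_prop
  obtain ⟨s, hs, hs0, hs'⟩ := exists_contDiff_antideriv hs1 p.1
  refine ⟨fun r => (s r, z r, τ r), hs.prodMk (hz.prodMk hτ), ?_, fun r => ?_⟩
  · simp [hs0, hz0, hτ0]
  · exact (hs' r).prodMk ((hz' r).prodMk (hτ' r))

/-- If the Euler equation `x' = -x · x` has global solutions for all initial values, then the left
invariant connection is geodesically complete. -/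
theorem isGeodesicallyComplete_of_euler {P : OscModel →L[ℝ] OscModel →L[ℝ] OscModel}
    (hP : ∀ x₀, ∃ x : ℝ → OscModel, ContDiff ℝ ∞ x ∧ x 0 = x₀ ∧
      ∀ r, HasDerivAt x (-P (x r) (x r)) r) :
    IsGeodesicallyComplete (leftInvariantConnection P) := by
  intro p v
  obtain ⟨x, hx, hx0, hx'⟩ := hP (transCLM (invCoords (coords p)) v)
  obtain ⟨c, hc, hc0, hc'⟩ := exists_contDiff_hasDerivAt_transCLM hx (coords p)
  have h1 : deriv c = fun r => transCLM (c r) (x r) := funext fun r => (hc' r).deriv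
  refine ⟨fun r => ofCoords (c r), ⟨hc, fun r => ?_⟩, hc0, ?_⟩
  · change deriv (deriv c) r + christoffel _ (ofCoords (c r)) (deriv c r) (deriv c r) = 0
    have h2 := christoffel_leftInvariantConnection P (ofCoords (c r)) (x r) (x r)
    -- The second derivative of `c`: its `transDeriv` term cancels the one in the Christoffel
    -- symbol, and the Euler equation cancels `P x x`.
    have h3 := (hasDerivAt_transCLM (hc' r) (hx' r)).deriv
    rw [h1, h3]
    refine (congrArg _ h2).trans ?_
    change transCLM (c r) (-P (x r) (x r)) + transDeriv (c r) (transCLM (c r) (x r)) (x r) +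
      (transCLM (c r) (P (x r) (x r)) - transDeriv (c r) (transCLM (c r) (x r)) (x r)) = 0
    rw [map_neg]
    abel
  · change deriv c 0 = v
    rw [h1]
    beta_reduce
    rw [hc0, hx0, transCLM_transCLM_invCoords]

/-! ### Algebraic identities of the three products -/

theorem ext_coords {a b : OscModel} (h₀ : a.1 = b.1) (h₁ : a.2.1.re = b.2.1.re)
    (h₂ : a.2.1.im = b.2.1.im) (h₃ : a.2.2 = b.2.2) : a = b :=
  Prod.ext h₀ (Prod.ext (Complex.ext h₁ h₂) h₃)

theorem prodF₁_apply (t s q : ℝ) (a b : OscModel) : prodF₁ t s q a b =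
    (t * (a.2.1.re * b.2.1.re + a.2.1.im * b.2.1.im) +
      q * (a.2.1.re * b.2.1.im - a.2.1.im * b.2.1.re) + s * (a.2.2 * b.2.2),
      ⟨-(a.2.2 * b.2.1.im), a.2.2 * b.2.1.re⟩, 0) := by
  rw [prodF₁, tableProduct_apply]
  apply ext_coords <;> (simp [Fin.sum_univ_four, coordCLM, e₀, e₁, e₂]; try ring)

theorem prodF₃_apply (q : ℝ) (a b : OscModel) : prodF₃ q a b =
    (q * (a.2.1.re * b.2.1.im - a.2.1.im * b.2.1.re),
      ⟨-(a.2.2 * b.2.1.im), a.2.2 * b.2.1.re⟩,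
      a.2.1.re * b.2.1.re + a.2.1.im * b.2.1.im) := by
  rw [prodF₃, tableProduct_apply]
  apply ext_coords <;> (simp [Fin.sum_univ_four, coordCLM, e₀, e₁, e₂, d]; try ring)

theorem prodF₄_apply (q : ℝ) (a b : OscModel) : prodF₄ q a b =
    (q * (a.2.1.re * b.2.1.im - a.2.1.im * b.2.1.re + a.2.1.re * b.2.2 + a.2.2 * b.2.1.re
        - (a.2.1.im * b.2.2 + a.2.2 * b.2.1.im) / 2),
      ⟨(a.2.1.re * b.2.1.re + a.2.1.im * b.2.1.im) / 2 + a.2.1.re * b.2.2 / 4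
          + a.2.1.im * b.2.2 / 2 + a.2.2 * b.2.1.re / 4 - a.2.2 * b.2.1.im / 2
          - 3 / 8 * (a.2.2 * b.2.2),
        a.2.1.re * b.2.1.re + a.2.1.im * b.2.1.im + a.2.1.re * b.2.2 / 2 + a.2.1.im * b.2.2
          + 3 / 2 * (a.2.2 * b.2.1.re) + a.2.2 * b.2.1.im + 7 / 4 * (a.2.2 * b.2.2)⟩,
      -(a.2.1.re * b.2.1.re + a.2.1.im * b.2.1.im + a.2.1.re * b.2.2 / 2 + a.2.1.im * b.2.2
          + a.2.2 * b.2.1.re / 2 + a.2.2 * b.2.1.im + 5 / 4 * (a.2.2 * b.2.2))) := by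
  rw [prodF₄, tableProduct_apply]
  apply ext_coords <;> (simp [Fin.sum_univ_four, coordCLM, e₀, e₁, e₂, d]; try ring)

/-- The value `q = 1 / 2` is forced here: the commutator of `e₁` and `e₂` is `2q • e₀`. -/
theorem prodF₁_sub_prodF₁ (t s : ℝ) (a b : OscModel) :
    prodF₁ t s (1 / 2) a b - prodF₁ t s (1 / 2) b a = bracket a b := by
  simp only [prodF₁_apply, bracket]
  apply ext_coords <;> (simp; try ring)

theorem prodF₃_sub_prodF₃ (a b : OscModel) :
    prodF₃ (1 / 2) a b - prodF₃ (1 / 2) b a = bracket a b := by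
  simp only [prodF₃_apply, bracket]
  apply ext_coords <;> (simp; try ring)

theorem prodF₄_sub_prodF₄ (a b : OscModel) :
    prodF₄ (1 / 2) a b - prodF₄ (1 / 2) b a = bracket a b := by
  simp only [prodF₄_apply, bracket]
  apply ext_coords <;> (simp; try ring)

theorem prodF₁_leftSymmetric (t s : ℝ) (a b c : OscModel) :
    prodF₁ t s (1 / 2) a (prodF₁ t s (1 / 2) b c) - prodF₁ t s (1 / 2) b (prodF₁ t s (1 / 2) a c) =
      prodF₁ t s (1 / 2) (bracket a b) c := by
  simp only [prodF₁_apply, bracket]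
  apply ext_coords <;> (simp; try ring)

theorem prodF₃_leftSymmetric (a b c : OscModel) :
    prodF₃ (1 / 2) a (prodF₃ (1 / 2) b c) - prodF₃ (1 / 2) b (prodF₃ (1 / 2) a c) =
      prodF₃ (1 / 2) (bracket a b) c := by
  simp only [prodF₃_apply, bracket]
  apply ext_coords <;> (simp; try ring)

theorem prodF₄_leftSymmetric (a b c : OscModel) :
    prodF₄ (1 / 2) a (prodF₄ (1 / 2) b c) - prodF₄ (1 / 2) b (prodF₄ (1 / 2) a c) =
      prodF₄ (1 / 2) (bracket a b) c := by
  simp only [prodF₄_apply, bracket]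
  apply ext_coords <;> (simp; try ring)

/-! ### Explicit solutions of the Euler equations -/

theorem normSq_rot_mul (t : ℝ) (z : ℂ) : Complex.normSq (rot t * z) = Complex.normSq z := by
  have h : Complex.normSq (rot t) = 1 := by
    rw [Complex.normSq_eq_norm_sq, rot, Complex.norm_exp_ofReal_mul_I, one_pow]
  rw [map_mul, h, one_mul]

/-- The phase of the rotating component, whose speed is minus the `d`-component `δ + R * r`. -/
theorem hasDerivAt_mul_add_sq (δ R r : ℝ) :
    HasDerivAt (fun r : ℝ => -(δ * r + R * r ^ 2 / 2)) (-(δ + R * r)) r := by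
  have h := (((hasDerivAt_id r).const_mul δ).add
    ((((hasDerivAt_id r).pow 2).const_mul R).div_const 2)).neg
  refine h.congr_deriv ?_
  simp
  ring

theorem prodF₁_euler (t s q : ℝ) (x₀ : OscModel) : ∃ x : ℝ → OscModel, ContDiff ℝ ∞ x ∧ x 0 = x₀ ∧
    ∀ r, HasDerivAt x (-prodF₁ t s q (x r) (x r)) r := by
  obtain ⟨a, z, δ⟩ := x₀
  have hrot : ContDiff ℝ ∞ rot := contDiff_rot.of_le le_top
  -- Here the `d`-component is constant, which is the phase formula with `R = 0`; the `e₀`-component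
  -- has constant speed because the norm of `z` is conserved. The skew `q`-terms drop out of `x ·
  -- x`.
  refine ⟨fun r => (a - (t * Complex.normSq z + s * δ ^ 2) * r, rot (-(δ * r + 0 * r ^ 2 / 2)) * z,
    δ), by fun_prop, by simp [rot_zero], fun r => ?_⟩
  have h1 := (hasDerivAt_rot_comp (hasDerivAt_mul_add_sq δ 0 r)).mul_const z
  have h0 := ((hasDerivAt_id r).const_mul (t * Complex.normSq z + s * δ ^ 2)).const_sub a
  refine (h0.prodMk (h1.prodMk (hasDerivAt_const r δ))).congr_deriv ?_
  have hn := normSq_rot_mul (-(δ * r + 0 * r ^ 2 / 2)) z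
  rw [prodF₁_apply, mul_assoc]
  beta_reduce
  generalize rot (-(δ * r + 0 * r ^ 2 / 2)) * z = ζ at hn ⊢
  rw [← hn, Complex.normSq_apply]
  apply ext_coords <;> (simp; try ring)

theorem prodF₃_euler (q : ℝ) (x₀ : OscModel) : ∃ x : ℝ → OscModel, ContDiff ℝ ∞ x ∧ x 0 = x₀ ∧
    ∀ r, HasDerivAt x (-prodF₃ q (x r) (x r)) r := by
  obtain ⟨a, z, δ⟩ := x₀
  have hrot : ContDiff ℝ ∞ rot := contDiff_rot.of_le le_top
  -- The equations are `z' = -iδz` and `δ' = -|z|²`; the first conserves `|z|`, so `R` is the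
  -- constant slope of `δ`.
  set R := -Complex.normSq z with hR
  refine ⟨fun r => (a, rot (-(δ * r + R * r ^ 2 / 2)) * z, δ + R * r), by fun_prop,
    by simp [rot_zero], fun r => ?_⟩
  have h1 := (hasDerivAt_rot_comp (hasDerivAt_mul_add_sq δ R r)).mul_const z
  have h2 := ((hasDerivAt_id r).const_mul R).const_add δ
  refine ((hasDerivAt_const r a).prodMk (h1.prodMk h2)).congr_deriv ?_
  have hn := normSq_rot_mul (-(δ * r + R * r ^ 2 / 2)) z
  rw [prodF₃_apply, mul_assoc]
  beta_reduce
  -- Only the norm of the rotated vector matters from here on, so a polynomial identity remains.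
  generalize rot (-(δ * r + R * r ^ 2 / 2)) * z = ζ at hn ⊢
  have hR' : R = -(ζ.re * ζ.re + ζ.im * ζ.im) := by rw [hR, ← hn, Complex.normSq_apply]
  generalize δ + R * r = D
  rw [hR']
  apply ext_coords <;> (simp [mul_comm]; try ring)

theorem prodF₄_euler (x₀ : OscModel) : ∃ x : ℝ → OscModel, ContDiff ℝ ∞ x ∧ x 0 = x₀ ∧
    ∀ r, HasDerivAt x (-prodF₄ (1 / 2) (x r) (x r)) r := by
  obtain ⟨a, z, δ⟩ := x₀
  have hrot : ContDiff ℝ ∞ rot := contDiff_rot.of_le le_top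
  -- Completing the square: the `d`-component of `-x · x` is `|z + δ(1/2 + i)|²`. With `ζ = z +
  -- δ(1/2 + i)` the system becomes `ζ' = -iδζ`, `δ' = |ζ|²`, the previous case up to a sign.
  set ζ₀ : ℂ := z + δ • (⟨1 / 2, 1⟩ : ℂ) with hζ₀
  set R := Complex.normSq ζ₀ with hR
  -- Chosen so that `a - L ζ` is conserved: the Euler equation gives `a' = δ(Im ζ / 2 - Re ζ)`,
  -- which is `L (-iδζ)`.
  set L : ℂ →L[ℝ] ℝ := Complex.imCLM + (1 / 2 : ℝ) • Complex.reCLM with hL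
  refine ⟨fun r => (a - L ζ₀ + L (rot (-(δ * r + R * r ^ 2 / 2)) * ζ₀),
    rot (-(δ * r + R * r ^ 2 / 2)) * ζ₀ - (δ + R * r) • (⟨1 / 2, 1⟩ : ℂ), δ + R * r),
    by fun_prop, ?_, fun r => ?_⟩
  · simp [rot_zero, hζ₀]
  have h1 := (hasDerivAt_rot_comp (hasDerivAt_mul_add_sq δ R r)).mul_const ζ₀
  have h2 : HasDerivAt (fun r => δ + R * r) (R * 1) r :=
    ((hasDerivAt_id r).const_mul R).const_add δ
  have h0 : HasDerivAt (fun r => L (rot (-(δ * r + R * r ^ 2 / 2)) * ζ₀)) _ r :=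
    L.hasFDerivAt.comp_hasDerivAt r h1
  refine ((h0.const_add (a - L ζ₀)).prodMk
    ((h1.sub (h2.smul_const (⟨1 / 2, 1⟩ : ℂ))).prodMk h2)).congr_deriv ?_
  have hn := normSq_rot_mul (-(δ * r + R * r ^ 2 / 2)) ζ₀
  rw [prodF₄_apply, mul_assoc]
  beta_reduce
  generalize rot (-(δ * r + R * r ^ 2 / 2)) * ζ₀ = ζ at hn ⊢
  have hR' : R = ζ.re * ζ.re + ζ.im * ζ.im := by rw [hR, ← hn, Complex.normSq_apply]
  generalize δ + R * r = D
  rw [hR']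
  apply ext_coords <;> (simp [hL]; try ring)

end OscGroup
end

theorem mainTheorem7 (t s : ℝ) (ht : 0 ≤ t) (hs : 0 ≤ s)
    (P : OscModel →L[ℝ] OscModel →L[ℝ] OscModel)
    (hP : P = OscGroup.prodF₁ t s (1 / 2) ∨ P = OscGroup.prodF₃ (1 / 2) ∨
      P = OscGroup.prodF₄ (1 / 2)) :
    OscGroup.IsLeftInvariant (OscGroup.leftInvariantConnection P) ∧
    OscGroup.IsTorsionFree (OscGroup.leftInvariantConnection P) ∧
    OscGroup.IsCurvatureFree (OscGroup.leftInvariantConnection P) ∧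
    OscGroup.IsGeodesicallyComplete (OscGroup.leftInvariantConnection P) := by
  refine ⟨OscGroup.isLeftInvariant_leftInvariantConnection P,
    OscGroup.isTorsionFree_leftInvariantConnection ?_,
    OscGroup.isCurvatureFree_leftInvariantConnection ?_,
    OscGroup.isGeodesicallyComplete_of_euler ?_⟩
  · rcases hP with rfl | rfl | rfl
    exacts [OscGroup.prodF₁_sub_prodF₁ t s, OscGroup.prodF₃_sub_prodF₃,
      OscGroup.prodF₄_sub_prodF₄]
  · rcases hP with rfl | rfl | rfl
    exacts [OscGroup.prodF₁_leftSymmetric t s, OscGroup.prodF₃_leftSymmetric,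
      OscGroup.prodF₄_leftSymmetric]
  · rcases hP with rfl | rfl | rfl
    exacts [OscGroup.prodF₁_euler t s _, OscGroup.prodF₃_euler _, OscGroup.prodF₄_euler]
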